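/- Let $F$ be an algebraically closed field of characteristic zero with infinite transcendence degree over $\mathbb{Q}$, and let $n\ge 1$ be an integer. Let ${\rm SO}_n(F)$ be the group of $n\times n$ matrices $A$ over $F$ with $AA^T={\rm I}_n$ and $\det A=1$. Every field automorphism $\varphi$ of $F$ induces an automorphism $\varphi_n$ of ${\rm SO}_n(F)$, $\varphi_n((a_{i,j}))=(\varphi(a_{i,j}))$. For an automorphism $\psi$ of a group $G$, elements $x,y\in G$ are called $\psi$-conjugate if $x=zy\psi(z)^{-1}$ for some $z\in G$; this is an equivalence relation, and the Reidemeister number $R(\psi)$ is the number of its classes (a positive integer or $\infty$). Then there exists an automorphism $\varphi$ of $F$ (possibly depending on $n$) such that the induced automorphism $\varphi_n$ of ${\rm SO}_n(F)$ satisfies $R(\varphi_n)=1$; that is, every matrix in ${\rm SO}_n(F)$ is $\varphi_n$-conjugate to ${\rm I}_n$ within ${\rm SO}_n(F)$. -/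

import Mathlib

/-- The relation of `φ`-conjugacy on a group `G`, for an automorphism `φ` of `G`:
`x` and `y` are `φ`-conjugate if `x = z * y * φ(z)⁻¹` for some `z` in `G`. -/
def TwistedConj {G : Type*} [Group G] (φ : G ≃* G) (x y : G) : Prop :=
  ∃ z : G, x = z * y * (φ z)⁻¹

/-- `φ`-conjugacy is an equivalence relation. -/
theorem twistedConj_equivalence {G : Type*} [Group G] (φ : G ≃* G) :
    Equivalence (TwistedConj φ) where
  refl x := ⟨1, by simp⟩
  symm := by
    rintro x y ⟨z, rfl⟩
    exact ⟨z⁻¹, by simp [mul_assoc]⟩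
  trans := by
    rintro x y w ⟨z, rfl⟩ ⟨t, rfl⟩
    exact ⟨z * t, by simp [mul_assoc]⟩

/-- `φ`-conjugacy as a setoid; its classes are the `φ`-conjugacy classes. -/
def twistedConjSetoid {G : Type*} [Group G] (φ : G ≃* G) : Setoid G :=
  ⟨TwistedConj φ, twistedConj_equivalence φ⟩

/-- The Reidemeister number `R(φ)`: the number of `φ`-conjugacy classes, a positive integer or `∞`
(infinite cardinals are not distinguished). -/
noncomputable def reidemeisterNumber {G : Type*} [Group G] (φ : G ≃* G) : ℕ∞ :=
  ENat.card (Quotient (twistedConjSetoid φ))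

/-- Applying a ring homomorphism to each entry preserves the special orthogonal group. -/
theorem map_mem_specialOrthogonalGroup {F : Type*} [Field F] {n : ℕ} (φ : F →+* F)
    {A : Matrix (Fin n) (Fin n) F} (hA : A ∈ Matrix.specialOrthogonalGroup (Fin n) F) :
    A.map φ ∈ Matrix.specialOrthogonalGroup (Fin n) F := by
  rw [Matrix.mem_specialOrthogonalGroup_iff, Matrix.mem_orthogonalGroup_iff] at hA ⊢
  refine ⟨?_, ?_⟩
  · rw [← Matrix.transpose_map, ← Matrix.map_mul, hA.1, Matrix.map_one _ φ.map_zero φ.map_one]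
  · rw [← RingHom.mapMatrix_apply, ← RingHom.map_det, hA.2, map_one]

/-- The automorphism `φ_n` of `SO_n(F)` induced by a field automorphism `φ` of `F`:
it applies `φ` to each entry of a matrix. -/
def inducedSO {F : Type*} [Field F] (n : ℕ) (φ : F ≃+* F) :
    Matrix.specialOrthogonalGroup (Fin n) F ≃* Matrix.specialOrthogonalGroup (Fin n) F where
  toFun A := ⟨A.1.map φ, map_mem_specialOrthogonalGroup (φ : F →+* F) A.2⟩
  invFun A := ⟨A.1.map φ.symm, map_mem_specialOrthogonalGroup (φ.symm : F →+* F) A.2⟩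
  left_inv A := by ext i j; simp
  right_inv A := by ext i j; simp
  map_mul' A B := by
    apply Subtype.ext
    exact Matrix.map_mul (f := (φ : F →+* F))

/-!
Fix an automorphism `σ` of a field `K`, adjoin to `K` independent generic matrices `X_A`, one for
every `A ∈ GL_n(K)` and every `n`, and extend `σ` by `σ(X_A) = A⁻¹ * X_A`: then `X_A` solves the
Lang equation `A * σ(Z) = Z`. Starting from `K = F`, the algebraic closure of the resulting field
is again isomorphic to `F` by Steinitz' theorem, so this can be iterated. The limit is once more a
copy of `F`, with an automorphism `φ` for which `Z ↦ Z * φ(Z)⁻¹` maps `GL_n(F)` onto itself for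
every `n`.

For `A ∈ SO_n(F)`, a solution `Z ∈ GL_n(F)` of `A * φ(Z) = Z` gives a `φ`-invariant symmetric
matrix `Zᵀ * Z`. Diagonalising it over the fixed field of `φ` and taking square roots of the
diagonal entries, which `φ` preserves up to sign, makes `Z` orthogonal at the price of
`A * φ(Y) = Y * D` for a diagonal sign matrix `D`. Comparing determinants, `D` has an even number
of entries `-1`, so `D = μ(-1)` for a `φ`-invariant cocharacter `μ` of `SO_n`; if
`φ(c) = -c`, then `W = Y * μ(c)` satisfies `A * φ(W) = W`.
-/

universe u

section Steinitz

open Cardinal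

variable {F K : Type u} [Field F] [Field K] [IsAlgClosed F] [IsAlgClosed K] [CharZero F]

theorem cardinalMk_eq_trdeg_rat (htr : ℵ₀ ≤ Algebra.trdeg ℚ F) : #F = Algebra.trdeg ℚ F := by
  obtain ⟨s, hs⟩ := exists_isTranscendenceBasis ℚ F
  refine le_antisymm ?_ (hs.cardinalMk_eq_trdeg ▸ mk_subtype_le s)
  have h := IsAlgClosed.cardinal_le_max_transcendence_basis _ hs
  simp only [lift_id, Cardinal.mkRat, hs.cardinalMk_eq_trdeg, lift_aleph0] at h
  exact h.trans (by simp [htr])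

theorem nonempty_ringEquiv_of_cardinalMk_le (htr : ℵ₀ ≤ Algebra.trdeg ℚ F) (f : F →+* K)
    (hK : #K ≤ #F) : Nonempty (F ≃+* K) := by
  have : CharZero K := charZero_of_injective_ringHom f.injective
  have hle : Algebra.trdeg ℚ F ≤ Algebra.trdeg ℚ K :=
    trdeg_le_of_injective f.toRatAlgHom f.injective
  obtain ⟨s, hs⟩ := exists_isTranscendenceBasis ℚ F
  obtain ⟨t, ht⟩ := exists_isTranscendenceBasis ℚ K
  have hst : #s = #t := by
    rw [hs.cardinalMk_eq_trdeg, ht.cardinalMk_eq_trdeg]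
    refine le_antisymm hle ?_
    rwa [← cardinalMk_eq_trdeg_rat htr, ← cardinalMk_eq_trdeg_rat (htr.trans hle)]
  obtain ⟨e⟩ := Cardinal.eq.1 hst
  exact ⟨IsAlgClosed.equivOfTranscendenceBasis _ _ e hs ht⟩

end Steinitz

section LangMap

open Matrix

/-- Solvability over `L` of every Lang equation `A * τ(Z) = Z` whose coefficient matrix `A` is an
invertible matrix over `K`, seen over `L` through `ι`. For `ι = id` this says that the Lang map
`Z ↦ Z * τ(Z)⁻¹` of `GL_n(L)` is surjective for every `n`. -/
def SolvesLangEquations {K L : Type*} [CommRing K] [CommRing L] (ι : K →+* L) (τ : L →+* L) :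
    Prop :=
  ∀ (n : ℕ) (A : GL (Fin n) K), ∃ Z : GL (Fin n) L,
    GeneralLinearGroup.map ι A * GeneralLinearGroup.map τ Z = Z

namespace SolvesLangEquations

variable {J K L M : Type*} [CommRing J] [CommRing K] [CommRing L] [CommRing M]
  {ι : K →+* L} {τ : L →+* L}

theorem comp_right (h : SolvesLangEquations ι τ) (j : J →+* K) :
    SolvesLangEquations (ι.comp j) τ := fun n A => by
  simpa only [GeneralLinearGroup.map_comp, MonoidHom.comp_apply] using
    h n (GeneralLinearGroup.map j A)

theorem comp_left (h : SolvesLangEquations ι τ) {e : L →+* M} {τ' : M →+* M}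
    (he : τ'.comp e = e.comp τ) : SolvesLangEquations (e.comp ι) τ' := fun n A => by
  obtain ⟨Z, hZ⟩ := h n A
  refine ⟨GeneralLinearGroup.map e Z, ?_⟩
  have hcomm : GeneralLinearGroup.map τ' (GeneralLinearGroup.map e Z) =
      GeneralLinearGroup.map e (GeneralLinearGroup.map τ Z) := by
    rw [← MonoidHom.comp_apply, ← GeneralLinearGroup.map_comp, he, GeneralLinearGroup.map_comp,
      MonoidHom.comp_apply]
  rw [hcomm, GeneralLinearGroup.map_comp, MonoidHom.comp_apply, ← map_mul, hZ]

theorem conj {τ : L ≃+* L} (h : SolvesLangEquations (RingHom.id L) (τ : L →+* L)) (e : K ≃+* L) :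
    SolvesLangEquations (RingHom.id K) ((e.trans τ).trans e.symm : K →+* K) := by
  have he := (h.comp_left (e := (e.symm : L →+* K)) (τ' := ((e.trans τ).trans e.symm : K ≃+* K))
    (RingHom.ext fun x => by simp)).comp_right (e : K →+* L)
  simpa using he

theorem exists_mul_map_eq {τ : L →+* L} (h : SolvesLangEquations (RingHom.id L) τ) (a : Lˣ) :
    ∃ c : Lˣ, a * τ c = c := by
  obtain ⟨Z, hZ⟩ := h 1 (GeneralLinearGroup.scalar (Fin 1) a)
  refine ⟨GeneralLinearGroup.det Z, ?_⟩
  have hdet := congrArg (fun Y => (GeneralLinearGroup.det Y : L)) hZ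
  simpa [GeneralLinearGroup.map_det] using hdet

end SolvesLangEquations

section GenericMatrices

variable {R : Type*} [CommRing R] {J : Type*} {m : J → Type*}

variable (R m) in
/-- The polynomial ring over `R` in the entries of independent generic square matrices, one with
index type `m a` for every `a`. -/
abbrev GenericMatrixRing : Type _ :=
  MvPolynomial (Σ a, m a × m a) R

variable (R) in
/-- The generic matrix with index `a`, whose entries are the corresponding variables. -/
noncomputable def genericMatrix (a : J) : Matrix (m a) (m a) (GenericMatrixRing R m) :=
  of fun i j => MvPolynomial.X ⟨a, i, j⟩

theorem genericMatrixRing_algHom_ext {S : Type*} [CommRing S] [Algebra R S]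
    {f g : GenericMatrixRing R m →ₐ[R] S}
    (h : ∀ a, (genericMatrix R a).map f = (genericMatrix R a).map g) : f = g :=
  MvPolynomial.algHom_ext fun p => congrFun (congrFun (h p.1) p.2.1) p.2.2

variable [∀ a, Fintype (m a)] [∀ a, DecidableEq (m a)]

theorem det_genericMatrix_ne_zero [Nontrivial R] (a : J) :
    (genericMatrix R a : Matrix (m a) (m a) (GenericMatrixRing R m)).det ≠ 0 := by
  have hrename : genericMatrix R a = (MvPolynomial.rename (Sigma.mk a)).mapMatrix
      (mvPolynomialX (m a) (m a) R) := by
    ext1 i j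
    simp [genericMatrix]
  rw [hrename, ← AlgHom.map_det]
  exact (map_ne_zero_iff _ (MvPolynomial.rename_injective _ sigma_mk_injective)).2
    (det_mvPolynomialX_ne_zero (m a) R)

/-- The endomorphism of the generic matrix ring that multiplies the generic matrix with index `a`
by `g a` on the left. -/
noncomputable def genericTranslate (g : ∀ a, GL (m a) R) :
    GenericMatrixRing R m →ₐ[R] GenericMatrixRing R m :=
  MvPolynomial.aeval fun p =>
    ((g p.1).1.map MvPolynomial.C * genericMatrix R p.1 :
      Matrix (m p.1) (m p.1) (GenericMatrixRing R m)) p.2.1 p.2.2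

theorem genericMatrix_map_genericTranslate (g : ∀ a, GL (m a) R) (a : J) :
    (genericMatrix R a).map (genericTranslate g) =
      (g a).1.map MvPolynomial.C * genericMatrix R a := by
  ext1 i j
  simp [genericMatrix, genericTranslate]

theorem genericTranslate_one :
    genericTranslate (1 : ∀ a, GL (m a) R) = AlgHom.id R (GenericMatrixRing R m) :=
  genericMatrixRing_algHom_ext fun a => by
    rw [genericMatrix_map_genericTranslate, Pi.one_apply, Units.val_one,
      Matrix.map_one _ (map_zero _) (map_one _), one_mul]
    rfl

theorem genericTranslate_comp (g h : ∀ a, GL (m a) R) :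
    (genericTranslate g).comp (genericTranslate h) = genericTranslate (h * g) :=
  genericMatrixRing_algHom_ext fun a => by
    have hC : ((h a).1.map MvPolynomial.C).map (genericTranslate g) =
        (h a).1.map MvPolynomial.C := by
      ext1 i j
      exact (genericTranslate g).commutes _
    rw [AlgHom.coe_comp, ← Matrix.map_map, genericMatrix_map_genericTranslate, Matrix.map_mul, hC,
      genericMatrix_map_genericTranslate, genericMatrix_map_genericTranslate, ← mul_assoc,
      ← Matrix.map_mul, Pi.mul_apply, Units.val_mul]

theorem exists_ringEquiv_genericMatrixRing (σ : R ≃+* R) (g : ∀ a, GL (m a) R) :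
    ∃ θ : GenericMatrixRing R m ≃+* GenericMatrixRing R m,
      (∀ x, θ (MvPolynomial.C x) = MvPolynomial.C (σ x)) ∧
      ∀ a, (genericMatrix R a).map θ = (g a).1.map MvPolynomial.C *
        genericMatrix R a := by
  let translate : GenericMatrixRing R m ≃ₐ[R] GenericMatrixRing R m :=
    AlgEquiv.ofAlgHom (genericTranslate g) (genericTranslate g⁻¹)
      (by rw [genericTranslate_comp, inv_mul_cancel, genericTranslate_one])
      (by rw [genericTranslate_comp, mul_inv_cancel, genericTranslate_one])
  refine ⟨(MvPolynomial.mapEquiv _ σ).trans translate.toRingEquiv, fun x => ?_, fun a => ?_⟩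
  · simpa using translate.commutes (σ x)
  · rw [← genericMatrix_map_genericTranslate]
    ext1 i j
    simp [genericMatrix, translate]

end GenericMatrices

section GenericClosure

variable {K : Type*} [Field K] {J : Type*} {m : J → Type*}

theorem exists_ringEquiv_algebraicClosure_fractionRing {R : Type*} [CommRing R] [IsDomain R]
    (θ : R ≃+* R) :
    ∃ ψ : AlgebraicClosure (FractionRing R) ≃+* AlgebraicClosure (FractionRing R),
      ∀ r, ψ (algebraMap R _ r) = algebraMap R _ (θ r) := by
  let θ' : FractionRing R ≃+* FractionRing R := IsFractionRing.ringEquivOfRingEquiv θ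
  refine ⟨IsAlgClosure.equivOfEquiv _ _ θ', fun r => ?_⟩
  rw [IsScalarTower.algebraMap_apply R (FractionRing R), IsAlgClosure.equivOfEquiv_algebraMap,
    IsFractionRing.ringEquivOfRingEquiv_algebraMap, ← IsScalarTower.algebraMap_apply]

variable (K m) in
/-- The algebraic closure of the field generated over `K` by the entries of independent generic
matrices. -/
abbrev GenericClosure : Type _ :=
  AlgebraicClosure (FractionRing (GenericMatrixRing K m))

theorem exists_ringEquiv_genericClosure [∀ a, Fintype (m a)] [∀ a, DecidableEq (m a)]
    (σ : K ≃+* K) (A : ∀ a, GL (m a) K) :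
    ∃ τ : GenericClosure K m ≃+* GenericClosure K m,
      (∀ x, τ (algebraMap K _ x) = algebraMap K _ (σ x)) ∧
      ∀ a, ∃ Z : GL (m a) (GenericClosure K m),
        GeneralLinearGroup.map (algebraMap K _) (A a) *
          GeneralLinearGroup.map (τ : GenericClosure K m →+* GenericClosure K m) Z = Z := by
  obtain ⟨θ, hθC, hθX⟩ := exists_ringEquiv_genericMatrixRing σ A⁻¹
  obtain ⟨τ, hτ⟩ := exists_ringEquiv_algebraicClosure_fractionRing θ
  let f := algebraMap (GenericMatrixRing K m) (GenericClosure K m)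
  have hf : Function.Injective f :=
    (algebraMap (FractionRing (GenericMatrixRing K m)) _).injective.comp
      (IsFractionRing.injective _ _)
  refine ⟨τ, fun x => ?_, fun a => ?_⟩
  · simp only [IsScalarTower.algebraMap_apply K (GenericMatrixRing K m),
      MvPolynomial.algebraMap_eq, hτ, hθC]
  · have hdet : ((genericMatrix K a).map f).det ≠ 0 := by
      rw [← RingHom.mapMatrix_apply, ← RingHom.map_det]
      exact (map_ne_zero_iff f hf).2 (det_genericMatrix_ne_zero a)
    refine ⟨GeneralLinearGroup.mkOfDetNeZero _ hdet, Units.ext ?_⟩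
    have hA : (A a).1.map (algebraMap K (GenericClosure K m)) =
        ((A a).1.map MvPolynomial.C).map f := by
      ext1 i j
      exact IsScalarTower.algebraMap_apply K (GenericMatrixRing K m) _ _
    have hX : ((genericMatrix K a).map f).map τ = ((genericMatrix K a).map θ).map f := by
      ext1 i j
      exact hτ _
    change (A a).1.map (algebraMap K _) * ((genericMatrix K a).map f).map τ =
      (genericMatrix K a).map f
    rw [hA, hX, hθX, ← Matrix.map_mul, ← mul_assoc, ← Matrix.map_mul, Pi.inv_apply,
      ← Units.val_mul, mul_inv_cancel, Units.val_one, Matrix.map_one _ (map_zero _) (map_one _),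
      one_mul]

end GenericClosure

section Cardinality

open Cardinal

theorem cardinalMk_generalLinearGroup_le {R : Type u} [CommRing R] [Infinite R] (n : ℕ) :
    #(GL (Fin n) R) ≤ #R := by
  have hfun : #(Fin n × Fin n → R) ≤ #R := by
    have h := power_nat_le_max (c := #R) (n := n * n)
    rw [max_eq_left (aleph0_le_mk R)] at h
    simpa using h
  refine (mk_le_of_injective (f := fun (A : GL (Fin n) R) (p : Fin n × Fin n) => A p.1 p.2)
    fun A B h => ?_).trans hfun
  ext i j
  exact congrFun h (i, j)

theorem cardinalMk_genericClosure_le {K J : Type u} {m : J → Type} [Field K] [Infinite K]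
    [∀ a, Finite (m a)] (hJ : #J ≤ #K) : #(GenericClosure K m) ≤ #K := by
  have hK := aleph0_le_mk K
  refine (Algebra.IsAlgebraic.cardinalMk_le_max (FractionRing (GenericMatrixRing K m)) _).trans
    (max_le ?_ hK)
  rw [mk_fractionRing]
  refine MvPolynomial.cardinalMk_le_max.trans (max_le (max_le le_rfl ?_) hK)
  rw [mk_sigma]
  refine (sum_le_sum _ (fun _ => ℵ₀) fun a => mk_le_aleph0).trans ?_
  simpa using mul_le_of_le hK hJ hK

/-- The generic closure of `K` with one generic matrix for every coefficient matrix of a Lang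
equation over `K`. -/
abbrev LangClosure (K : Type*) [Field K] : Type _ :=
  GenericClosure K fun A : Σ n, GL (Fin n) K => Fin A.1

theorem cardinalMk_langClosure_le {K : Type u} [Field K] [Infinite K] : #(LangClosure K) ≤ #K := by
  refine cardinalMk_genericClosure_le ?_
  rw [mk_sigma]
  refine (sum_le_sum _ (fun _ => #K) fun n => cardinalMk_generalLinearGroup_le n).trans ?_
  simp [aleph0_le_mk]

end Cardinality

theorem exists_ringEquiv_langClosure {K : Type*} [Field K] (σ : K ≃+* K) :
    ∃ τ : LangClosure K ≃+* LangClosure K,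
      (∀ x, τ (algebraMap K _ x) = algebraMap K _ (σ x)) ∧
      SolvesLangEquations (algebraMap K _) (τ : LangClosure K →+* LangClosure K) := by
  obtain ⟨τ, hτ, hsolve⟩ := exists_ringEquiv_genericClosure σ fun A : Σ n, GL (Fin n) K => A.2
  exact ⟨τ, hτ, fun n A => hsolve ⟨n, A⟩⟩

theorem exists_ringHom_forall_exists_solvesLangEquations {F : Type u} [Field F] [IsAlgClosed F]
    [CharZero F] (htr : Cardinal.aleph0 ≤ Algebra.trdeg ℚ F) :
    ∃ ι : F →+* F, ∀ σ : F ≃+* F, ∃ τ : F ≃+* F, (∀ x, τ (ι x) = ι (σ x)) ∧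
      SolvesLangEquations ι (τ : F →+* F) := by
  obtain ⟨e⟩ := nonempty_ringEquiv_of_cardinalMk_le htr (algebraMap F (LangClosure F))
    cardinalMk_langClosure_le
  refine ⟨(e.symm : LangClosure F →+* F).comp (algebraMap F _), fun σ => ?_⟩
  obtain ⟨τ, hτ, hsolve⟩ := exists_ringEquiv_langClosure σ
  exact ⟨(e.trans τ).trans e.symm, fun x => by simp [hτ],
    hsolve.comp_left (RingHom.ext fun x => by simp)⟩

section DirectLimits

variable {ι : Type*} [Preorder ι] [IsDirectedOrder ι] [Nonempty ι] {G : ι → Type*}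

theorem exists_forall_directLimit_of_eq [∀ i, CommRing (G i)] {f : ∀ i j, i ≤ j → G i →+* G j}
    [DirectedSystem G (f · · ·)] {α : Type*} [Finite α] (x : α → DirectLimit G f) :
    ∃ i, ∃ y : α → G i, ∀ a, DirectLimit.Ring.of G f i (y a) = x a := by
  choose k y hy using fun a => DirectLimit.exists_eq_mk f (x a)
  obtain ⟨i, hi⟩ := (Set.finite_range k).bddAbove
  have hki : ∀ a, k a ≤ i := fun a => hi ⟨a, rfl⟩
  exact ⟨i, fun a => f (k a) i (hki a) (y a), fun a =>
    (DirectLimit.Ring.of_f (hki a) (y a)).trans (hy a).symm⟩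

variable [∀ i, Field (G i)] {f : ∀ i j, i ≤ j → G i →+* G j} [DirectedSystem G (f · · ·)]

instance isAlgClosed_directLimit [∀ i, IsAlgClosed (G i)] : IsAlgClosed (DirectLimit G f) := by
  refine IsAlgClosed.of_exists_root _ fun p _ hp => ?_
  obtain ⟨i, y, hy⟩ := exists_forall_directLimit_of_eq fun k : Fin (p.natDegree + 1) => p.coeff k
  have hlift : p ∈ Polynomial.lifts (DirectLimit.Ring.of G f i) := by
    rw [Polynomial.lifts_iff_coeff_lifts]
    intro k
    by_cases hk : k < p.natDegree + 1
    · exact ⟨y ⟨k, hk⟩, hy ⟨k, hk⟩⟩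
    · exact ⟨0, by rw [map_zero, Polynomial.coeff_eq_zero_of_natDegree_lt (by lia)]⟩
  obtain ⟨q, rfl⟩ := (Polynomial.mem_lifts _).1 hlift
  have hq : q.degree ≠ 0 := by
    rw [← Polynomial.degree_map q (DirectLimit.Ring.of G f i)]
    exact hp.degree_pos.ne'
  obtain ⟨x, hx⟩ := IsAlgClosed.exists_root q hq
  exact ⟨DirectLimit.Ring.of G f i x, by rw [Polynomial.eval_map_apply, hx, map_zero]⟩

theorem exists_map_directLimit_of_eq {m : Type*} [Fintype m] [DecidableEq m]
    (A : GL m (DirectLimit G f)) :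
    ∃ i, ∃ B : GL m (G i), GeneralLinearGroup.map (DirectLimit.Ring.of G f i) B = A := by
  obtain ⟨i, y, hy⟩ := exists_forall_directLimit_of_eq fun p : m × m => A.1 p.1 p.2
  have hmap : (of fun k l => y (k, l)).map (DirectLimit.Ring.of G f i) = A.1 :=
    Matrix.ext fun k l => hy (k, l)
  have hdet : (of fun k l => y (k, l)).det ≠ 0 := by
    rw [← map_ne_zero (DirectLimit.Ring.of G f i), RingHom.map_det, RingHom.mapMatrix_apply, hmap]
    exact (GeneralLinearGroup.det A).ne_zero
  exact ⟨i, GeneralLinearGroup.mkOfDetNeZero _ hdet, Units.ext hmap⟩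

/-- The automorphism of a direct limit of fields induced by a compatible family of automorphisms
of its terms. -/
noncomputable def directLimitEquiv (σ : ∀ i, G i ≃+* G i)
    (hσ : ∀ i j h x, σ j (f i j h x) = f i j h (σ i x)) : DirectLimit G f ≃+* DirectLimit G f :=
  RingEquiv.ofBijective
    (DirectLimit.Ring.lift G f _ (fun i => (DirectLimit.Ring.of G f i).comp (σ i))
      fun i j h x => by
        simp only [RingHom.comp_apply, RingHom.coe_coe, hσ, DirectLimit.Ring.of_f])
    ⟨RingHom.injective _, fun x => by
      obtain ⟨i, y, rfl⟩ := DirectLimit.exists_eq_mk f x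
      exact ⟨DirectLimit.Ring.of G f i ((σ i).symm y),
        congrArg (DirectLimit.Ring.of G f i) ((σ i).apply_symm_apply y)⟩⟩

theorem directLimitEquiv_of (σ : ∀ i, G i ≃+* G i)
    (hσ : ∀ i j h x, σ j (f i j h x) = f i j h (σ i x)) (i : ι) (x : G i) :
    directLimitEquiv σ hσ (DirectLimit.Ring.of G f i x) = DirectLimit.Ring.of G f i (σ i x) :=
  rfl

theorem solvesLangEquations_directLimitEquiv (σ : ∀ i, G i ≃+* G i)
    (hσ : ∀ i j h x, σ j (f i j h x) = f i j h (σ i x))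
    (hsolve : ∀ i, ∃ j, ∃ h : i ≤ j, SolvesLangEquations (f i j h) (σ j : G j →+* G j)) :
    SolvesLangEquations (RingHom.id _)
      (directLimitEquiv σ hσ : DirectLimit G f →+* DirectLimit G f) := fun n A => by
  obtain ⟨i, B, rfl⟩ := exists_map_directLimit_of_eq A
  obtain ⟨j, hij, hj⟩ := hsolve i
  have hof : (DirectLimit.Ring.of G f j).comp (f i j hij) = DirectLimit.Ring.of G f i :=
    RingHom.ext (DirectLimit.Ring.of_f hij)
  have hlim := hj.comp_left (e := DirectLimit.Ring.of G f j)
    (τ' := (directLimitEquiv σ hσ : DirectLimit G f →+* DirectLimit G f))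
    (RingHom.ext (directLimitEquiv_of σ hσ j))
  rw [hof] at hlim
  simpa only [GeneralLinearGroup.map_id, MonoidHom.id_apply] using hlim n B

end DirectLimits

section IterateLimit

variable {F : Type u} [Field F] (ι : F →+* F)

/-- The transition maps of the sequence `F → F → F → ⋯` with all steps equal to `ι`. -/
def iterateTransition (i j : ℕ) (_ : i ≤ j) : F →+* F :=
  ι ^ (j - i)

theorem iterateTransition_succ (i : ℕ) : iterateTransition ι i (i + 1) (Nat.le_succ i) = ι := by
  rw [iterateTransition, Nat.add_sub_cancel_left, pow_one]

instance directedSystem_iterateTransition :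
    DirectedSystem (fun _ : ℕ => F) (iterateTransition ι · · ·) where
  map_self i x := by simp [iterateTransition]
  map_map k j i hij hjk x := by
    have hsub : k - i = (k - j) + (j - i) := by lia
    simp [iterateTransition, hsub, pow_add]

/-- The direct limit of the sequence `F → F → F → ⋯` with all steps equal to `ι`. -/
abbrev IterateLimit : Type u :=
  DirectLimit (fun _ : ℕ => F) (iterateTransition ι)

variable {ι}

theorem iterateTransition_comm {σ : ℕ → F ≃+* F} (hσ : ∀ i x, σ (i + 1) (ι x) = ι (σ i x))
    (i j : ℕ) (h : i ≤ j) (x : F) :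
    σ j (iterateTransition ι i j h x) = iterateTransition ι i j h (σ i x) := by
  obtain ⟨k, rfl⟩ := Nat.exists_eq_add_of_le h
  rw [iterateTransition, Nat.add_sub_cancel_left, RingHom.coe_pow]
  induction k with
  | zero => rfl
  | succ k ih =>
    rw [Function.iterate_succ_apply', Function.iterate_succ_apply', ← add_assoc, hσ,
      ih (Nat.le_add_right i k)]

theorem cardinalMk_iterateLimit_le [Infinite F] :
    Cardinal.mk (IterateLimit ι) ≤ Cardinal.mk F := by
  have hsurj : Function.Surjective fun p : ℕ × F =>
      DirectLimit.Ring.of (fun _ : ℕ => F) (iterateTransition ι) p.1 p.2 := fun x => by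
    obtain ⟨i, y, rfl⟩ := DirectLimit.exists_eq_mk _ x
    exact ⟨(i, y), rfl⟩
  refine (Cardinal.mk_le_of_surjective hsurj).trans ?_
  simp [Cardinal.aleph0_le_mk]

end IterateLimit

theorem exists_ringEquiv_solvesLangEquations {F : Type u} [Field F] [IsAlgClosed F] [CharZero F]
    (htr : Cardinal.aleph0 ≤ Algebra.trdeg ℚ F) :
    ∃ φ : F ≃+* F, (∃ I : F, I * I = -1 ∧ φ I = I) ∧
      SolvesLangEquations (RingHom.id F) (φ : F →+* F) := by
  obtain ⟨ι, hι⟩ := exists_ringHom_forall_exists_solvesLangEquations htr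
  choose next hnext hsolve using hι
  let σ : ℕ → F ≃+* F := fun i => next^[i] (RingEquiv.refl F)
  have hσ : ∀ i, σ (i + 1) = next (σ i) := fun i => Function.iterate_succ_apply' ..
  have hcomm := iterateTransition_comm (ι := ι) (σ := σ) fun i x => by rw [hσ, hnext]
  let of₀ := DirectLimit.Ring.of (fun _ : ℕ => F) (iterateTransition ι) 0
  let ψ := directLimitEquiv (f := iterateTransition ι) σ hcomm
  have hψ := solvesLangEquations_directLimitEquiv (f := iterateTransition ι) σ hcomm fun i =>
    ⟨i + 1, Nat.le_succ i, by rw [iterateTransition_succ, hσ]; exact hsolve (σ i)⟩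
  obtain ⟨e⟩ := nonempty_ringEquiv_of_cardinalMk_le htr of₀ cardinalMk_iterateLimit_le
  obtain ⟨I, hI⟩ := IsAlgClosed.exists_eq_mul_self (-1 : F)
  have hfix : ψ (of₀ I) = of₀ I := directLimitEquiv_of σ hcomm 0 I
  refine ⟨(e.trans ψ).trans e.symm, ⟨e.symm (of₀ I), ?_, by simp [hfix]⟩, hψ.conj e⟩
  simp only [← map_mul, ← hI, map_neg, map_one]

section SymmetricMatrices

variable {k : Type*} [Field k] {m : Type*} [Fintype m] [DecidableEq m]

theorem exists_transpose_mul_mul_eq_diagonal (h2 : (2 : k) ≠ 0) {G : Matrix m m k}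
    (hG : G.IsSymm) : ∃ (B : GL m k) (d : m → k), B.1ᵀ * G * B.1 = diagonal d := by
  have : Invertible (2 : k) := invertibleOfNonzero h2
  obtain ⟨v, hv⟩ := LinearMap.BilinForm.exists_orthogonal_basis
    (LinearMap.BilinForm.isSymm_iff.1 (isSymm_toBilin'_iff_isSymm.2 hG))
  let w := v.reindex (Fintype.equivOfCardEq (by simp) : Fin (Module.finrank k (m → k)) ≃ m)
  let b := Pi.basisFun k m
  have hb : IsUnit (b.toMatrix w) := by
    have := b.invertibleToMatrix w
    exact isUnit_of_invertible _
  refine ⟨hb.unit, fun i => toBilin' G (w i) (w i), ?_⟩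
  have hchange : (b.toMatrix w)ᵀ * G * b.toMatrix w =
      LinearMap.BilinForm.toMatrix w (toBilin' G) := by
    rw [← LinearMap.BilinForm.toMatrix_mul_basis_toMatrix b w (toBilin' G),
      LinearMap.BilinForm.toMatrix_basisFun, LinearMap.BilinForm.toMatrix'_toBilin']
  rw [IsUnit.unit_spec, hchange]
  ext i j
  rw [LinearMap.BilinForm.toMatrix_apply, diagonal_apply]
  split_ifs with hij
  · rw [hij]
  · simp only [w, Module.Basis.reindex_apply]
    exact hv (by simpa using hij)

theorem exists_fixed_transpose_mul_mul_eq_diagonal (h2 : (2 : k) ≠ 0) (φ : k →+* k)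
    {G : Matrix m m k} (hG : G.IsSymm) (hφG : G.map φ = G) :
    ∃ (B : GL m k) (d : m → k), B.1.map φ = B.1 ∧ (∀ i, φ (d i) = d i) ∧
      B.1ᵀ * G * B.1 = diagonal d := by
  let k₀ : Subfield k := φ.eqLocusField (RingHom.id k)
  let G₀ : Matrix m m k₀ := of fun i j => ⟨G i j, congrFun (congrFun hφG i) j⟩
  have hG₀ : G₀.IsSymm := Matrix.ext fun i j => Subtype.ext (hG.apply i j)
  obtain ⟨B, d, hBd⟩ := exists_transpose_mul_mul_eq_diagonal
    (fun h => h2 (congrArg k₀.subtype h)) hG₀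
  refine ⟨GeneralLinearGroup.map k₀.subtype B, fun i => d i, ?_, fun i => (d i).2, ?_⟩
  · exact Matrix.ext fun i j => (B.1 i j).2
  · have hmap := congrArg (fun N : Matrix m m k₀ => N.map k₀.subtype) hBd
    rw [Matrix.map_mul, Matrix.map_mul, diagonal_map (map_zero k₀.subtype)] at hmap
    exact hmap

end SymmetricMatrices

section SignMatrix

variable {R : Type*} [CommRing R] {m : Type*} [DecidableEq m]

variable (R) in
/-- The diagonal matrix with entry `-1` at the indices in `S` and `1` elsewhere. -/
def signMatrix (S : Finset m) : Matrix m m R :=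
  diagonal (S.piecewise (-1) 1)

theorem signMatrix_map {R' : Type*} [CommRing R'] (f : R →+* R') (S : Finset m) :
    (signMatrix R S).map f = signMatrix R' S := by
  rw [signMatrix, diagonal_map (map_zero f)]
  congr 1
  ext i
  by_cases hi : i ∈ S <;> simp [hi]

theorem signMatrix_eq_one_sub (S : Finset m) :
    signMatrix R S = 1 - (2 : R) • diagonal (S.piecewise 1 0) := by
  rw [signMatrix, ← diagonal_smul, ← diagonal_one, diagonal_sub]
  congr 1
  ext i
  by_cases hi : i ∈ S
  · simp only [hi, Finset.piecewise_eq_of_mem, Pi.neg_apply, Pi.one_apply, Pi.smul_apply,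
      smul_eq_mul]
    ring
  · simp [hi]

variable [Fintype m]

theorem signMatrix_mem_orthogonalGroup (S : Finset m) : signMatrix R S ∈ orthogonalGroup m R := by
  rw [mem_orthogonalGroup_iff, signMatrix, diagonal_transpose, diagonal_mul_diagonal,
    ← diagonal_one]
  congr 1
  ext i
  by_cases hi : i ∈ S <;> simp [hi]

theorem det_signMatrix (S : Finset m) : (signMatrix R S).det = (-1) ^ S.card := by
  simp [signMatrix, Finset.prod_piecewise]

theorem signMatrix_commute (S T : Finset m) : Commute (signMatrix R S) (signMatrix R T) := by
  rw [commute_iff_eq, signMatrix, signMatrix, diagonal_mul_diagonal, diagonal_mul_diagonal]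
  simp only [mul_comm]

end SignMatrix

section Orthogonal

variable {F : Type*} [Field F] {m : Type*} [Fintype m] [DecidableEq m]

theorem exists_transpose_mul_mul_eq_one_map_eq (h2 : (2 : F) ≠ 0) (hsq : ∀ x : F, IsSquare x)
    (φ : F →+* F) {G : Matrix m m F} (hG : G.IsSymm) (hφG : G.map φ = G) (hdet : G.det ≠ 0) :
    ∃ (P : Matrix m m F) (S : Finset m), Pᵀ * G * P = 1 ∧ P.map φ = P * signMatrix F S := by
  obtain ⟨B, d, hφB, hφd, hBd⟩ := exists_fixed_transpose_mul_mul_eq_diagonal h2 φ hG hφG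
  choose δ hδ using fun i => hsq (d i)
  have hδ0 : ∀ i, δ i ≠ 0 := by
    have hprod : ∏ i, d i ≠ 0 := by
      rw [← det_diagonal, ← hBd, det_mul, det_mul, det_transpose]
      have hB := (GeneralLinearGroup.det B).ne_zero
      exact mul_ne_zero (mul_ne_zero hB hdet) hB
    intro i hi
    exact Finset.prod_ne_zero_iff.1 hprod i (Finset.mem_univ i) (by rw [hδ, hi, mul_zero])
  have hφδ : ∀ i, φ (δ i) = δ i ∨ φ (δ i) = -δ i := fun i =>
    mul_self_eq_mul_self_iff.1 (by rw [← map_mul, ← hδ, hφd])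
  classical
  refine ⟨B.1 * diagonal δ⁻¹, ({i | φ (δ i) ≠ δ i} : Finset m), ?_, ?_⟩
  · have hscale : (B.1 * diagonal δ⁻¹)ᵀ * G * (B.1 * diagonal δ⁻¹) =
        diagonal δ⁻¹ * (B.1ᵀ * G * B.1) * diagonal δ⁻¹ := by
      simp only [transpose_mul, diagonal_transpose, mul_assoc]
    rw [hscale, hBd, diagonal_mul_diagonal, diagonal_mul_diagonal, ← diagonal_one]
    congr 1
    ext i
    rw [Pi.inv_apply, hδ, inv_mul_cancel_left₀ (hδ0 i), mul_inv_cancel₀ (hδ0 i)]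
  · rw [Matrix.map_mul, hφB, diagonal_map (map_zero φ), mul_assoc, signMatrix,
      diagonal_mul_diagonal]
    congr 2
    ext i
    by_cases hi : φ (δ i) = δ i
    · simp [hi]
    · rw [Finset.piecewise_eq_of_mem _ _ _ (by simpa using hi)]
      simp [(hφδ i).resolve_left hi]

variable {φ : F →+* F} {A : Matrix m m F}

theorem exists_orthogonal_mul_map_eq_mul_signMatrix (h2 : (2 : F) ≠ 0)
    (hsq : ∀ x : F, IsSquare x) (hA : A ∈ orthogonalGroup m F) {Z : GL m F}
    (hZ : A * Z.1.map φ = Z.1) :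
    ∃ Y ∈ orthogonalGroup m F, ∃ S, A * Y.map φ = Y * signMatrix F S := by
  have hφG : (Z.1ᵀ * Z.1).map φ = Z.1ᵀ * Z.1 := by
    conv_rhs => rw [← hZ]
    rw [transpose_mul, mul_assoc, ← mul_assoc Aᵀ, (mem_orthogonalGroup_iff' _ _).1 hA, one_mul,
      Matrix.map_mul, transpose_map]
  have hdet : (Z.1ᵀ * Z.1).det ≠ 0 := by
    rw [det_mul, det_transpose]
    exact mul_self_ne_zero.2 (GeneralLinearGroup.det Z).ne_zero
  obtain ⟨P, S, hP, hφP⟩ := exists_transpose_mul_mul_eq_one_map_eq h2 hsq φ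
    (isSymm_transpose_mul_self Z.1) hφG hdet
  refine ⟨Z.1 * P, (mem_orthogonalGroup_iff' _ _).2 ?_, S, ?_⟩
  · simpa only [transpose_mul, mul_assoc] using hP
  · rw [Matrix.map_mul, hφP, ← mul_assoc, ← mul_assoc, hZ]

theorem det_eq_one_or_neg_one_of_mem_orthogonalGroup (hA : A ∈ orthogonalGroup m F) :
    A.det = 1 ∨ A.det = -1 := by
  rw [← mul_self_eq_one_iff]
  simpa using congrArg det ((mem_orthogonalGroup_iff _ _).1 hA)

theorem even_card_of_mul_map_eq_mul_signMatrix (h2 : (2 : F) ≠ 0) (hA : A.det = 1)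
    {Y : Matrix m m F} (hY : Y ∈ orthogonalGroup m F) {S : Finset m}
    (hAY : A * Y.map φ = Y * signMatrix F S) : Even S.card := by
  have hφ : φ Y.det = Y.det := by
    rcases det_eq_one_or_neg_one_of_mem_orthogonalGroup hY with h | h <;> simp [h]
  have hY0 : Y.det ≠ 0 := by
    rcases det_eq_one_or_neg_one_of_mem_orthogonalGroup hY with h | h <;> simp [h]
  have hsign : Y.det * 1 = Y.det * (-1) ^ S.card := by
    rw [← det_signMatrix (R := F), ← det_mul, ← hAY, det_mul, hA, ← RingHom.mapMatrix_apply,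
      ← RingHom.map_det, hφ, mul_comm]
  by_contra hodd
  have hone : (1 : F) = (-1) ^ S.card := mul_left_cancel₀ hY0 hsign
  rw [(Nat.not_even_iff_odd.1 hodd).neg_one_pow] at hone
  exact h2 (by linear_combination hone)

theorem exists_specialOrthogonal_mul_map_eq_mul_signMatrix (h2 : (2 : F) ≠ 0)
    (hsq : ∀ x : F, IsSquare x) (hA : A ∈ specialOrthogonalGroup m F) {Z : GL m F}
    (hZ : A * Z.1.map φ = Z.1) :
    ∃ Y ∈ specialOrthogonalGroup m F, ∃ S, Even S.card ∧ A * Y.map φ = Y * signMatrix F S := by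
  obtain ⟨hAO, hAdet⟩ := mem_specialOrthogonalGroup_iff.1 hA
  obtain ⟨Y, hY, S, hAY⟩ := exists_orthogonal_mul_map_eq_mul_signMatrix h2 hsq hAO hZ
  have hS := even_card_of_mul_map_eq_mul_signMatrix h2 hAdet hY hAY
  rcases det_eq_one_or_neg_one_of_mem_orthogonalGroup hY with hdet | hdet
  · exact ⟨Y, mem_specialOrthogonalGroup_iff.2 ⟨hY, hdet⟩, S, hS, hAY⟩
  rcases isEmpty_or_nonempty m with hm | ⟨⟨i⟩⟩
  · exact ⟨Y, mem_specialOrthogonalGroup_iff.2 ⟨hY, det_isEmpty⟩, S, hS, hAY⟩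
  refine ⟨Y * signMatrix F {i}, mem_specialOrthogonalGroup_iff.2
    ⟨mul_mem hY (signMatrix_mem_orthogonalGroup _), ?_⟩, S, hS, ?_⟩
  · simp [hdet, det_signMatrix]
  · rw [Matrix.map_mul, signMatrix_map, ← mul_assoc, hAY, mul_assoc, mul_assoc,
      (signMatrix_commute S {i}).eq]

end Orthogonal

section IsotropicTorus

variable {R : Type*} [CommRing R] {m : Type*}

/-- An idempotent matrix such that its image and the image of its transpose are totally isotropic
for the standard symmetric bilinear form. -/
structure IsIsotropicIdempotent [Fintype m] (e : Matrix m m R) : Prop where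
  mul_self : e * e = e
  mul_transpose : e * eᵀ = 0
  transpose_mul : eᵀ * e = 0

variable [DecidableEq m]

/-- The cocharacter of the orthogonal group attached to an isotropic idempotent `e`: it has
weight `1` on the image of `e` and weight `-1` on the image of `eᵀ`, and it is trivial on the
orthogonal complement of their sum. -/
def isotropicCocharacter (e : Matrix m m R) (c : Rˣ) : Matrix m m R :=
  1 - e - eᵀ + (c : R) • e + (↑c⁻¹ : R) • eᵀ

theorem isotropicCocharacter_one (e : Matrix m m R) : isotropicCocharacter e 1 = 1 := by
  simp only [isotropicCocharacter, inv_one, Units.val_one, one_smul]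
  abel

theorem isotropicCocharacter_neg_one (e : Matrix m m R) :
    isotropicCocharacter e (-1) = 1 - (2 : R) • (e + eᵀ) := by
  simp only [isotropicCocharacter, inv_neg_one, Units.val_neg, Units.val_one]
  module

theorem isotropicCocharacter_transpose (e : Matrix m m R) (c : Rˣ) :
    (isotropicCocharacter e c)ᵀ = isotropicCocharacter e c⁻¹ := by
  simp only [isotropicCocharacter, transpose_add, transpose_sub, transpose_smul, transpose_one,
    transpose_transpose, inv_inv]
  abel

theorem isotropicCocharacter_map {R' : Type*} [CommRing R'] (f : R →+* R') (e : Matrix m m R)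
    (c : Rˣ) : (isotropicCocharacter e c).map f =
      isotropicCocharacter (e.map f) (Units.map (f : R →* R') c) := by
  simp [isotropicCocharacter, Matrix.map_add, Matrix.map_sub, Matrix.map_smul', transpose_map]

namespace IsIsotropicIdempotent

variable [Fintype m] {e : Matrix m m R} (he : IsIsotropicIdempotent e)
include he

theorem isotropicCocharacter_mul (c d : Rˣ) :
    isotropicCocharacter e c * isotropicCocharacter e d = isotropicCocharacter e (c * d) := by
  have htranspose : eᵀ * eᵀ = eᵀ := by rw [← Matrix.transpose_mul, he.mul_self]
  simp only [isotropicCocharacter, mul_add, add_mul, mul_sub, sub_mul, one_mul, mul_one,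
    smul_mul_assoc, mul_smul_comm, he.mul_self, he.mul_transpose, he.transpose_mul, htranspose,
    _root_.mul_inv, Units.val_mul]
  module

theorem isotropicCocharacter_mem_orthogonalGroup (c : Rˣ) :
    isotropicCocharacter e c ∈ orthogonalGroup m R := by
  rw [mem_orthogonalGroup_iff, isotropicCocharacter_transpose, he.isotropicCocharacter_mul,
    mul_inv_cancel, isotropicCocharacter_one]

theorem isotropicCocharacter_mem_specialOrthogonalGroup {c : Rˣ} (hc : IsSquare c) :
    isotropicCocharacter e c ∈ specialOrthogonalGroup m R := by
  refine mem_specialOrthogonalGroup_iff.2 ⟨he.isotropicCocharacter_mem_orthogonalGroup c, ?_⟩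
  obtain ⟨b, rfl⟩ := hc
  have hdet := congrArg det
    ((mem_orthogonalGroup_iff _ _).1 (he.isotropicCocharacter_mem_orthogonalGroup b))
  rw [← he.isotropicCocharacter_mul, det_mul]
  simpa using hdet

omit [DecidableEq m] in
theorem submatrix {l : Type*} [Fintype l] (f : l ≃ m) :
    IsIsotropicIdempotent (e.submatrix f f) where
  mul_self := by rw [submatrix_mul_equiv, he.mul_self]
  mul_transpose := by
    rw [transpose_submatrix, submatrix_mul_equiv, he.mul_transpose, submatrix_zero]; rfl
  transpose_mul := by
    rw [transpose_submatrix, submatrix_mul_equiv, he.transpose_mul, submatrix_zero]; rfl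

omit [DecidableEq m] in
theorem fromBlocks_zero {l : Type*} [Fintype l] :
    IsIsotropicIdempotent (fromBlocks e 0 0 (0 : Matrix l l R)) where
  mul_self := by simp [fromBlocks_multiply, he.mul_self]
  mul_transpose := by simp [fromBlocks_transpose, fromBlocks_multiply, he.mul_transpose]
  transpose_mul := by simp [fromBlocks_transpose, fromBlocks_multiply, he.transpose_mul]

end IsIsotropicIdempotent

end IsotropicTorus

section SpecialOrthogonal

variable {F : Type*} [Field F] {m : Type*} [Fintype m] [DecidableEq m] {φ : F →+* F}

omit [Fintype m] in
theorem transpose_inv_two_smul_one_add {N : Matrix m m F} (hN : Nᵀ = -N) :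
    ((2⁻¹ : F) • (1 + N))ᵀ = (2⁻¹ : F) • (1 - N) := by
  rw [transpose_smul, transpose_add, transpose_one, hN, sub_eq_add_neg]

theorem isIsotropicIdempotent_inv_two_smul_one_add (h2 : (2 : F) ≠ 0) {N : Matrix m m F}
    (hN : N * N = 1) (hNt : Nᵀ = -N) : IsIsotropicIdempotent ((2⁻¹ : F) • (1 + N)) where
  mul_self := by
    have hsquare : (1 + N) * (1 + N) = (2 : F) • (1 + N) := by
      simp only [mul_add, add_mul, one_mul, mul_one, hN]
      module
    rw [smul_mul_smul_comm, hsquare, smul_smul, mul_assoc, inv_mul_cancel₀ h2, mul_one]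
  mul_transpose := by
    have hproduct : (1 + N) * (1 - N) = 1 - N * N := by noncomm_ring
    rw [transpose_inv_two_smul_one_add hNt, smul_mul_smul_comm, hproduct, hN, sub_self, smul_zero]
  transpose_mul := by
    have hproduct : (1 - N) * (1 + N) = 1 - N * N := by noncomm_ring
    rw [transpose_inv_two_smul_one_add hNt, smul_mul_smul_comm, hproduct, hN, sub_self, smul_zero]

theorem exists_isIsotropicIdempotent_add_transpose_eq_one (h2 : (2 : F) ≠ 0) {I : F}
    (hI : I * I = -1) (hφI : φ I = I) :
    ∃ e : Matrix (m ⊕ m) (m ⊕ m) F, IsIsotropicIdempotent e ∧ e.map φ = e ∧ e + eᵀ = 1 := by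
  have hN : (I • J m F) * (I • J m F) = 1 := by
    rw [smul_mul_smul_comm, hI, J_squared, neg_smul_neg, one_smul]
  have hNt : (I • J m F)ᵀ = -(I • J m F) := by rw [transpose_smul, J_transpose, smul_neg]
  refine ⟨(2⁻¹ : F) • (1 + I • J m F), isIsotropicIdempotent_inv_two_smul_one_add h2 hN hNt,
    ?_, ?_⟩
  · rw [Matrix.map_smul' _ _ _ (map_mul φ), Matrix.map_add _ (map_add φ),
      Matrix.map_one _ (map_zero φ) (map_one φ), Matrix.map_smul' _ _ _ (map_mul φ), map_J, hφI,
      map_inv₀, map_ofNat]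
  · rw [transpose_inv_two_smul_one_add hNt, ← smul_add, add_add_sub_cancel, smul_add, ← add_smul,
      ← two_mul, mul_inv_cancel₀ h2, one_smul]

theorem exists_isIsotropicIdempotent_add_transpose_eq_diagonal (h2 : (2 : F) ≠ 0) {I : F}
    (hI : I * I = -1) (hφI : φ I = I) {S : Finset m} (hS : Even S.card) :
    ∃ e : Matrix m m F, IsIsotropicIdempotent e ∧ e.map φ = e ∧
      e + eᵀ = diagonal (S.piecewise 1 0) := by
  obtain ⟨k, hk⟩ := hS
  let f : (Fin k ⊕ Fin k) ⊕ {i // i ∉ S} ≃ m :=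
    ((Fintype.equivOfCardEq (by simp [hk]) : Fin k ⊕ Fin k ≃ S).sumCongr (Equiv.refl _)).trans
      (Equiv.sumCompl (· ∈ S))
  obtain ⟨e, he, hφe, hadd⟩ :=
    exists_isIsotropicIdempotent_add_transpose_eq_one (m := Fin k) h2 hI hφI
  refine ⟨(fromBlocks e 0 0 0).submatrix f.symm f.symm, he.fromBlocks_zero.submatrix f.symm,
    ?_, ?_⟩
  · rw [← submatrix_map, fromBlocks_map, hφe]
    simp only [Matrix.map_zero _ (map_zero φ)]
  · have hblock : fromBlocks e 0 0 0 + (fromBlocks e 0 0 0)ᵀ =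
        diagonal (Sum.elim 1 0 : (Fin k ⊕ Fin k) ⊕ {i // i ∉ S} → F) := by
      rw [fromBlocks_transpose, fromBlocks_add, hadd, transpose_zero, transpose_zero,
        transpose_zero, add_zero, add_zero, add_zero, ← diagonal_one, ← diagonal_zero,
        fromBlocks_diagonal]
      rfl
    have hentries : (Sum.elim 1 0 : _ → F) ∘ f.symm = S.piecewise (1 : m → F) 0 := by
      ext i
      obtain ⟨j | j, rfl⟩ := f.surjective i
      · have hj : f (Sum.inl j) ∈ S := Subtype.coe_prop _
        simp [hj]
      · have hj : f (Sum.inr j) ∉ S := j.2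
        simp [hj]
    rw [← hentries, ← submatrix_diagonal_equiv, ← hblock]
    rfl

theorem exists_isotropicCocharacter_neg_one_eq_signMatrix (h2 : (2 : F) ≠ 0) {I : F}
    (hI : I * I = -1) (hφI : φ I = I) {S : Finset m} (hS : Even S.card) :
    ∃ e : Matrix m m F, IsIsotropicIdempotent e ∧ e.map φ = e ∧
      isotropicCocharacter e (-1) = signMatrix F S := by
  obtain ⟨e, he, hφe, hadd⟩ :=
    exists_isIsotropicIdempotent_add_transpose_eq_diagonal h2 hI hφI hS
  exact ⟨e, he, hφe, by rw [isotropicCocharacter_neg_one, hadd, signMatrix_eq_one_sub]⟩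

theorem exists_specialOrthogonal_mul_map_eq (h2 : (2 : F) ≠ 0) (hsq : ∀ x : F, IsSquare x)
    {I : F} (hI : I * I = -1) (hφI : φ I = I) {c : Fˣ} (hc : -φ c = c)
    {A : Matrix m m F} (hA : A ∈ specialOrthogonalGroup m F) {Z : GL m F}
    (hZ : A * Z.1.map φ = Z.1) :
    ∃ W ∈ specialOrthogonalGroup m F, A * W.map φ = W := by
  obtain ⟨Y, hY, S, hS, hAY⟩ :=
    exists_specialOrthogonal_mul_map_eq_mul_signMatrix h2 hsq hA hZ
  obtain ⟨e, he, hφe, heS⟩ := exists_isotropicCocharacter_neg_one_eq_signMatrix h2 hI hφI hS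
  have hcsq : IsSquare c := by
    obtain ⟨b, hb⟩ := hsq c
    exact ⟨Units.mk0 b fun hb0 => c.ne_zero (by rw [hb, hb0, mul_zero]), Units.ext hb⟩
  have hφc : -1 * Units.map (φ : F →* F) c = c := Units.ext (by simpa using hc)
  refine ⟨Y * isotropicCocharacter e c,
    mul_mem hY (he.isotropicCocharacter_mem_specialOrthogonalGroup hcsq), ?_⟩
  rw [Matrix.map_mul, ← mul_assoc, hAY, isotropicCocharacter_map, hφe, ← heS, mul_assoc,
    he.isotropicCocharacter_mul, hφc]

end SpecialOrthogonal

section TwistedConjugacy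

theorem reidemeisterNumber_eq_one_iff {G : Type*} [Group G] (φ : G ≃* G) :
    reidemeisterNumber φ = 1 ↔ ∀ x, TwistedConj φ x 1 := by
  rw [reidemeisterNumber, ENat.card_eq_one_iff_unique, unique_iff_subsingleton_and_nonempty]
  constructor
  · rintro ⟨hsub, -⟩ x
    exact Quotient.exact (hsub.elim (Quotient.mk (twistedConjSetoid φ) x) (Quotient.mk _ 1))
  · intro h
    refine ⟨⟨fun a b => ?_⟩, ⟨Quotient.mk _ 1⟩⟩
    induction a, b using Quotient.inductionOn₂ with
    | h x y => exact (Quotient.sound (h x)).trans (Quotient.sound (h y)).symm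

theorem twistedConj_inducedSO_one {F : Type*} [Field F] {n : ℕ} {φ : F ≃+* F}
    {A : specialOrthogonalGroup (Fin n) F} {W : Matrix (Fin n) (Fin n) F}
    (hW : W ∈ specialOrthogonalGroup (Fin n) F) (hAW : A.1 * W.map φ = W) :
    TwistedConj (inducedSO n φ) A 1 := by
  refine ⟨⟨W, hW⟩, ?_⟩
  rw [mul_one, eq_mul_inv_iff_mul_eq]
  exact Subtype.ext hAW

end TwistedConjugacy

end LangMap

theorem corollary1_general {F : Type*} [Field F] [IsAlgClosed F] [CharZero F]
    (htr : Cardinal.aleph0 ≤ Algebra.trdeg ℚ F) :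
    ∃ φ : F ≃+* F, ∀ n : ℕ,
      reidemeisterNumber (inducedSO n φ) = 1 ∧
      ∀ A : Matrix.specialOrthogonalGroup (Fin n) F, TwistedConj (inducedSO n φ) A 1 := by
  obtain ⟨φ, ⟨I, hI, hφI⟩, hφ⟩ := exists_ringEquiv_solvesLangEquations htr
  obtain ⟨c, hc⟩ := hφ.exists_mul_map_eq (-1)
  refine ⟨φ, fun n => ?_⟩
  rw [reidemeisterNumber_eq_one_iff, and_self]
  intro A
  have hdet : A.1.det ≠ 0 := by
    rw [(Matrix.mem_specialOrthogonalGroup_iff.1 A.2).2]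
    exact one_ne_zero
  obtain ⟨Z, hZ⟩ := hφ n (Matrix.GeneralLinearGroup.mkOfDetNeZero A.1 hdet)
  obtain ⟨W, hW, hAW⟩ := exists_specialOrthogonal_mul_map_eq two_ne_zero
    (fun x => IsAlgClosed.exists_eq_mul_self x) hI hφI (by simpa using hc) A.2
    (congrArg Units.val hZ)
  exact twistedConj_inducedSO_one hW hAW

theorem corollary1 {F : Type*} [Field F] [IsAlgClosed F] [CharZero F]
    (htr : Cardinal.aleph0 ≤ Algebra.trdeg ℚ F) (n : ℕ) (hn : 1 ≤ n) :
    ∃ φ : F ≃+* F,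
      reidemeisterNumber (inducedSO n φ) = 1 ∧
      ∀ A : Matrix.specialOrthogonalGroup (Fin n) F, TwistedConj (inducedSO n φ) A 1 :=
  (corollary1_general htr).imp fun _ hφ => hφ n
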